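/- A \emph{coherent configuration} $\mathcal X=(\Omega,S)$ on a finite set $\Omega$ is a partition $S$ of $\Omega\times\Omega$ (whose classes are called basis relations) such that the diagonal $1_\Omega$ is a union of basis relations, $s^*=\{(\beta,\alpha):(\alpha,\beta)\in s\}\in S$ for every $s\in S$, and for all $r,s,t\in S$ the number $c_{rs}^t=|\{\gamma\in\Omega:(\alpha,\gamma)\in r,\ (\gamma,\beta)\in s\}|$ is the same for all $(\alpha,\beta)\in t$. It is an \emph{association scheme} if $1_\Omega\in S$; its \emph{degree} is $|\Omega|$. It is \emph{schurian} if $S$ is the set of orbits on $\Omega\times\Omega$ of some permutation group $K\le\mathrm{Sym}(\Omega)$. Its automorphism group $\mathrm{Aut}(\mathcal X)$ consists of the permutations of $\Omega$ that map every basis relation onto itself. An \emph{algebraic isomorphism} $\varphi$ from $(\Omega,S)$ to $(\Omega',S')$ is a bijection $S\to S'$ that preserves the numbers $c_{rs}^t$; it is \emph{induced} by a bijection $f:\Omega\to\Omega'$ if $\varphi(s)=\{(f(\alpha),f(\beta)):(\alpha,\beta)\in s\}$ for all $s\in S$. A coherent configuration is \emph{separable} if every algebraic isomorphism from it to a coherent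 configuration is induced by a bijection of the underlying sets. A \emph{Cayley scheme} over a finite group $H$ is an association scheme on $H$ whose automorphism group contains all right translations of $H$. \textbf{Theorem.} For every prime $p\ge 5$ there exists an association scheme of degree $4p^2$ that is separable and not schurian. More precisely, let $p\ge5$ be a prime and $G=A\times P$ with $A=C_2\times C_2$ and $P=C_p\times C_p$. Let $a_1,a_2,a_3$ be the three nontrivial elements of $A$, let $P_1,P_2,P_3$ be pairwise distinct subgroups of $P$ of order $p$, and put $$\mathcal S=\{\{g\},\ P_ia_ig:\ g\in P,\ i\in\{1,2,3\}\},\qquad R=\{r(X):X\in\mathcal S\},\quad r(X)=\{(g,xg):x\in X,\ g\in G\}.$$ Then $\mathcal X=(G,R)$ is a Cayley scheme over $G$ of degree $4p^2$ that is separable and not schurian. Moreover, every coherent configuration to which there is an algebraic isomorphism from $\mathcal X$ has a regular automorphism group, and every algebraic isomorphism from $\mathcal X$ to a Cayley scheme over a finite group $H$ is induced by a group isomorphism $G\to H$. -/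

import Mathlib

universe u v

/-- A coherent configuration on a finite set `Ω`: a partition of `Ω × Ω` into basis relations such
that the diagonal is a union of basis relations, the transpose of a basis relation is a basis
relation, and for basis relations `r`, `s`, `t` the number of `γ` with `(α, γ) ∈ r`, `(γ, β) ∈ s`
is the same for all `(α, β) ∈ t`. -/
structure CoherentConfiguration (Ω : Type u) [Finite Ω] where
  rels : Set (Set (Ω × Ω))
  isPartition : Setoid.IsPartition rels
  diagonal_eq : ∃ T ⊆ rels, ⋃₀ T = Set.diagonal Ω
  swap_mem : ∀ s ∈ rels, Prod.swap ⁻¹' s ∈ rels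
  ncard_eq : ∀ r ∈ rels, ∀ s ∈ rels, ∀ t ∈ rels, ∀ x ∈ t, ∀ y ∈ t,
    {γ : Ω | (x.1, γ) ∈ r ∧ (γ, x.2) ∈ s}.ncard = {γ : Ω | (y.1, γ) ∈ r ∧ (γ, y.2) ∈ s}.ncard

namespace CoherentConfiguration

variable {Ω : Type u} [Finite Ω] (X : CoherentConfiguration Ω)

theorem nonempty_of_mem (t : X.rels) : (t : Set (Ω × Ω)).Nonempty :=
  Set.nonempty_iff_ne_empty.2 fun h => X.isPartition.1 (h ▸ t.2)

/-- The intersection number `c_{rs}^t`, computed at some pair of `t`. -/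
noncomputable def interNum (r s t : X.rels) : ℕ :=
  {γ : Ω | ((X.nonempty_of_mem t).some.1, γ) ∈ (r : Set (Ω × Ω)) ∧
    (γ, (X.nonempty_of_mem t).some.2) ∈ (s : Set (Ω × Ω))}.ncard

/-- The intersection number may be computed at any pair of `t`. -/
theorem interNum_eq (r s t : X.rels) {x : Ω × Ω} (hx : x ∈ (t : Set (Ω × Ω))) :
    X.interNum r s t =
      {γ : Ω | (x.1, γ) ∈ (r : Set (Ω × Ω)) ∧ (γ, x.2) ∈ (s : Set (Ω × Ω))}.ncard :=
  X.ncard_eq r r.2 s s.2 t t.2 _ (X.nonempty_of_mem t).some_mem x hx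

/-- An association scheme: the diagonal is a basis relation. -/
def IsAssociationScheme : Prop := Set.diagonal Ω ∈ X.rels

/-- Schurian: the basis relations are exactly the orbits on `Ω × Ω` of some permutation group. -/
def IsSchurian : Prop :=
  ∃ K : Subgroup (Equiv.Perm Ω), X.rels = Set.range fun x : Ω × Ω => MulAction.orbit K x

/-- The automorphism group: the permutations that map every basis relation onto itself. -/
def aut : Subgroup (Equiv.Perm Ω) where
  carrier := {f | ∀ s ∈ X.rels, ∀ α β : Ω, (f α, f β) ∈ s ↔ (α, β) ∈ s}
  one_mem' := fun _ _ _ _ => Iff.rfl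
  mul_mem' := fun {f g} hf hg s hs α β => (hf s hs (g α) (g β)).trans (hg s hs α β)
  inv_mem' := fun {f} hf s hs α β => by
    have h := hf s hs (f⁻¹ α) (f⁻¹ β)
    simpa using h.symm

/-- An algebraic isomorphism: a bijection between the sets of basis relations that preserves the
intersection numbers. -/
structure AlgIso {Ω' : Type v} [Finite Ω'] (X : CoherentConfiguration Ω)
    (Y : CoherentConfiguration Ω') where
  toEquiv : X.rels ≃ Y.rels
  interNum_map : ∀ r s t : X.rels,
    Y.interNum (toEquiv r) (toEquiv s) (toEquiv t) = X.interNum r s t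

/-- The algebraic isomorphism `φ` is induced by the bijection `f` of the underlying sets (which is
then a combinatorial isomorphism). -/
def AlgIso.IsInducedBy {Ω' : Type v} [Finite Ω'] {X : CoherentConfiguration Ω}
    {Y : CoherentConfiguration Ω'} (φ : AlgIso X Y) (f : Ω ≃ Ω') : Prop :=
  ∀ s : X.rels, (φ.toEquiv s : Set (Ω' × Ω')) = Prod.map f f '' (s : Set (Ω × Ω))

/-- Separable: every algebraic isomorphism to a coherent configuration is induced by a
combinatorial isomorphism. -/
def IsSeparable : Prop :=
  ∀ (Ω' : Type v) [Finite Ω'] (Y : CoherentConfiguration Ω') (φ : AlgIso X Y),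
    ∃ f : Ω ≃ Ω', φ.IsInducedBy f

/-- A Cayley scheme over a group `H`: an association scheme on `H` whose automorphism group
contains all right translations. -/
def IsCayleyScheme {H : Type u} [Group H] [Finite H] (X : CoherentConfiguration H) : Prop :=
  X.IsAssociationScheme ∧ ∀ h : H, Equiv.mulRight h ∈ X.aut

end CoherentConfiguration

/-- A permutation group is regular: any point is mapped to any point by exactly one element. -/
def IsRegularPermGroup {Ω : Type u} (K : Subgroup (Equiv.Perm Ω)) : Prop :=
  Nonempty Ω ∧ ∀ α β : Ω, ∃! f : Equiv.Perm Ω, f ∈ K ∧ f α = β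

/-- The binary relation `{(g, x g) : x ∈ X, g ∈ H}` on a group `H`. -/
def cayleyRel {H : Type u} [Group H] (X : Set H) : Set (H × H) :=
  {y | ∃ x ∈ X, ∃ g : H, y = (g, x * g)}

/-- The group `C_n × C_n`, written multiplicatively. -/
abbrev CyclicSq (n : ℕ) : Type := Multiplicative (ZMod n) × Multiplicative (ZMod n)

/-- The sets `{g}` and `P_i a_i g`, for `g ∈ P = C_p × C_p` and `i = 1, 2, 3`, in the group
`A × P` with `A = C_2 × C_2`. -/
def basicSets (p : ℕ) (a : Fin 3 → CyclicSq 2) (Q : Fin 3 → Subgroup (CyclicSq p)) :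
    Set (Set (CyclicSq 2 × CyclicSq p)) :=
  {X | ∃ g : CyclicSq p, X = {(1, g)} ∨
    ∃ i : Fin 3, X = (fun h : CyclicSq p => (a i, h * g)) '' (Q i : Set (CyclicSq p))}

/-! Let `N 1 = ⊥` and let `N (a i)` be the `i`-th subgroup of order `p`. The basic sets are the
cosets `{t} × N t g`, and everything follows from two properties of `N`. Compatibility, `N (s * t) ≤
N s ⊔ N t`, makes the coset partition coherent; it holds because two distinct subgroups of order `p`
generate `P`. Rigidity is the vanishing of an obstruction. Given an algebraic isomorphism to `Y` and
a point `ω`, choose for each `a` a point at color `(a, 1)` from `ω`. The points of `a` and `b` then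
have color `(b / a, c a b)`, with `c a b` defined modulo `N (b / a)`. Moving the point of `a` by the
thin color `(1, w a)` multiplies `c` by the coboundary `w b / w a`. Rigidity says that exactly one
normalized `w` trivializes `c`, so exactly one color-preserving map `A × P → Ω` sends `1` to `ω`.
Existence gives separability. Existence and uniqueness at every `ω` make the automorphism group
regular. A schurian scheme with trivial point stabilizers has only thin relations, which fails here.
For a Cayley scheme, `f (x * y)` and `f x * f y` are color maps in `x` that agree at `1`, so `f` is
a homomorphism. Rigidity for the Klein group is a count: the values `w (a i)` range over `p ^ 3`
triples, the three remaining conditions live in a product of quotients of order `p ^ 3`, and the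
homomorphism between them is injective because `p` is odd. -/

namespace CoherentConfiguration

/-! ### Generalities on algebraic isomorphisms -/

section General

variable {Ω : Type u} [Finite Ω] {Ω' : Type v} [Finite Ω']

theorem eq_of_mem_of_mem (X : CoherentConfiguration Ω) {r s : Set (Ω × Ω)} (hr : r ∈ X.rels)
    (hs : s ∈ X.rels) {x : Ω × Ω} (hxr : x ∈ r) (hxs : x ∈ s) : r = s :=
  (X.isPartition.2 x).unique ⟨hr, hxr⟩ ⟨hs, hxs⟩

/-- A basis relation that meets the diagonal is contained in the diagonal. -/
theorem eq_of_mem_of_diag_mem (X : CoherentConfiguration Ω) {s : Set (Ω × Ω)} (hs : s ∈ X.rels)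
    {α β γ : Ω} (hα : (α, α) ∈ s) (h : (β, γ) ∈ s) : β = γ := by
  obtain ⟨T, hT, hd⟩ := X.diagonal_eq
  have hmem : (α, α) ∈ ⋃₀ T := hd ▸ (rfl : α = α)
  obtain ⟨t, htT, ht⟩ := hmem
  obtain rfl := X.eq_of_mem_of_mem (hT htT) hs ht hα
  have : (β, γ) ∈ Set.diagonal Ω := hd ▸ ⟨t, htT, h⟩
  exact this

/-- An algebraic isomorphism preserves the existence of triangles with given colors. -/
theorem AlgIso.exists_triangle_iff {X : CoherentConfiguration Ω} {Y : CoherentConfiguration Ω'}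
    (φ : AlgIso X Y) (r s t : X.rels) {x : Ω × Ω} (hx : x ∈ (t : Set (Ω × Ω))) {y : Ω' × Ω'}
    (hy : y ∈ (φ.toEquiv t : Set (Ω' × Ω'))) :
    (∃ γ, (y.1, γ) ∈ (φ.toEquiv r : Set (Ω' × Ω')) ∧ (γ, y.2) ∈ (φ.toEquiv s : Set (Ω' × Ω'))) ↔
      ∃ γ, (x.1, γ) ∈ (r : Set (Ω × Ω)) ∧ (γ, x.2) ∈ (s : Set (Ω × Ω)) := by
  have h := φ.interNum_map r s t
  rw [X.interNum_eq r s t hx, Y.interNum_eq _ _ _ hy] at h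
  have h1 := Set.ncard_pos (Set.toFinite
    {γ | (y.1, γ) ∈ (φ.toEquiv r : Set (Ω' × Ω')) ∧ (γ, y.2) ∈ (φ.toEquiv s : Set (Ω' × Ω'))})
  rw [h, Set.ncard_pos (Set.toFinite _)] at h1
  exact h1.symm

/-- The identity algebraic isomorphism. -/
def AlgIso.refl (X : CoherentConfiguration Ω) : AlgIso X X where
  toEquiv := Equiv.refl _
  interNum_map _ _ _ := rfl

end General

end CoherentConfiguration

/-! ### Coset configurations -/

section Coloring

variable {A P : Type*} [CommGroup A] [CommGroup P]

/-- The elements `x` and `y` of `A × P` have the same first coordinate `a`, and their second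
coordinates lie in the same coset of `N a`. -/
def SameCoset (N : A → Subgroup P) (x y : A × P) : Prop :=
  y.1 = x.1 ∧ y.2 / x.2 ∈ N x.1

/-- The conditions on a family of subgroups under which the sets `{a} × N a g` are the basic sets
of a Schur ring over `A × P`. -/
structure IsCompatibleFamily (N : A → Subgroup P) : Prop where
  one : N 1 = ⊥
  inv : ∀ a, N a⁻¹ = N a
  mul : ∀ a b, N (a * b) ≤ N a ⊔ N b

/-- Every cochain `c`, antisymmetric modulo the family `N`, is modulo `N` the coboundary of exactly
one function `w` with `w 1 = 1`. -/
structure IsRigidFamily (N : A → Subgroup P) : Prop where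
  eq_one : ∀ w : A → P, w 1 = 1 → (∀ a b, w b / w a ∈ N (b / a)) → ∀ a, w a = 1
  exists_solution : ∀ c : A → A → P, (∀ a, c a a = 1) → (∀ a, c 1 a = 1) →
    (∀ a b, c a b * c b a ∈ N (b / a)) →
    ∃ w : A → P, w 1 = 1 ∧ ∀ a b, c a b * (w b / w a) ∈ N (b / a)

namespace SameCoset

variable {N : A → Subgroup P} {x y z : A × P}

theorem refl (x : A × P) : SameCoset N x x := ⟨rfl, by simp [one_mem]⟩

theorem symm (h : SameCoset N x y) : SameCoset N y x :=
  ⟨h.1.symm, by rw [h.1, ← inv_div]; exact inv_mem h.2⟩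

theorem trans (h : SameCoset N x y) (h' : SameCoset N y z) : SameCoset N x z :=
  ⟨h'.1.trans h.1, by
    have := mul_mem (h.1 ▸ h'.2) h.2
    rwa [div_mul_div_cancel] at this⟩

theorem inv (hN : IsCompatibleFamily N) (h : SameCoset N x y) : SameCoset N x⁻¹ y⁻¹ :=
  ⟨congrArg (·⁻¹) h.1, by
    have h2 : (y⁻¹).2 / (x⁻¹).2 = (y.2 / x.2)⁻¹ := by
      rw [Prod.snd_inv, Prod.snd_inv, inv_div, div_eq_mul_inv, div_eq_mul_inv, inv_inv, mul_comm]
    rw [h2, Prod.fst_inv, hN.inv]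
    exact inv_mem h.2⟩

theorem eq_of_fst_eq_one (hN : N 1 = ⊥) (h : SameCoset N x y) (hx : x.1 = 1) : y = x := by
  refine Prod.ext h.1 ?_
  have := h.2
  rw [hx, hN, Subgroup.mem_bot, div_eq_one] at this
  exact this

theorem one_iff (hN : N 1 = ⊥) : SameCoset N 1 x ↔ x = 1 :=
  ⟨fun h => h.eq_of_fst_eq_one hN rfl, fun h => h ▸ refl _⟩

theorem mul_left (g : P) (h : SameCoset N x y) : SameCoset N ((1, g) * x) ((1, g) * y) :=
  ⟨by simp [h.1], by simpa using h.2⟩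

end SameCoset

/-- The relation of all pairs `(α, β)` with `β / α` in the coset of `x`. -/
def cosetRel (N : A → Subgroup P) (x : A × P) : Set ((A × P) × (A × P)) :=
  {z | SameCoset N x (z.2 / z.1)}

theorem mem_cosetRel {N : A → Subgroup P} {x α β : A × P} :
    (α, β) ∈ cosetRel N x ↔ SameCoset N x (β / α) := Iff.rfl

theorem cosetRel_eq_iff {N : A → Subgroup P} {x y : A × P} :
    cosetRel N x = cosetRel N y ↔ SameCoset N x y := by
  constructor
  · intro h
    have : ((1 : A × P), y) ∈ cosetRel N y := by
      rw [mem_cosetRel, div_one]; exact .refl _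
    rw [← h, mem_cosetRel, div_one] at this
    exact this
  · intro h
    ext ⟨α, β⟩
    exact ⟨fun h' => h.symm.trans h', fun h' => h.trans h'⟩

/-- The quotients `β / α` and `β' / α'` differ by an element of `N z.1`, which compatibility splits
as `m * n` with `m ∈ N x.1` and `n ∈ N y.1`. Translation by `(α' / α) * (1, m)` carries midpoints to
midpoints: `m` is absorbed on the left side of the triangle and `n` on the right. Two such
inequalities give coherence. -/
theorem ncard_cosetRel_le [Finite A] [Finite P] {N : A → Subgroup P} (hN : IsCompatibleFamily N)
    {x y z α β α' β' : A × P} (h : SameCoset N z (β / α)) (h' : SameCoset N z (β' / α')) :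
    {γ | (α, γ) ∈ cosetRel N x ∧ (γ, β) ∈ cosetRel N y}.ncard ≤
      {γ | (α', γ) ∈ cosetRel N x ∧ (γ, β') ∈ cosetRel N y}.ncard := by
  rcases Set.eq_empty_or_nonempty {γ | (α, γ) ∈ cosetRel N x ∧ (γ, β) ∈ cosetRel N y} with
    he | ⟨γ₀, h₁, h₂⟩
  · simp [he]
  have hz : z.1 = x.1 * y.1 := by
    rw [← h.1, ← h₁.1, ← h₂.1]
    simp
  have hn := (h.symm.trans h').2
  rw [h.1, hz] at hn
  obtain ⟨m, hm, n, hn, hmn⟩ := Subgroup.mem_sup.1 (hN.mul _ _ hn)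
  refine Set.ncard_le_ncard_of_injOn (fun γ => γ * ((α' / α) * (1, m))) ?_
    (mul_left_injective _).injOn (Set.toFinite _)
  rintro γ ⟨h₁, h₂⟩
  have e1 : β'.1 / α'.1 = β.1 / α.1 := h'.1.trans h.1.symm
  have e2 : β'.2 = β.2 / α.2 * α'.2 * (m * n) := by
    have aux : ∀ {G : Type _} [AddCommGroup G] (a b a' b' : G),
        b' = b - a + a' + (b' - a' - (b - a)) := by intros; abel
    rw [hmn]
    exact aux (G := Additive P) _ _ _ _
  have e1' : β'.1 = β.1 / α.1 * α'.1 := by rw [← e1]; simp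
  constructor
  · refine ⟨?_, ?_⟩
    · rw [← h₁.1]; simp [div_eq_mul_inv, mul_comm, mul_left_comm]
    · have := mul_mem h₁.2 hm
      convert this using 1
      simp [div_eq_mul_inv, mul_comm, mul_left_comm]
  · refine ⟨?_, ?_⟩
    · have aux : ∀ {G : Type _} [AddCommGroup G] (a b a' c : G),
          b - a + a' - (c + ((a' - a) + 0)) = b - c := by intros; abel
      rw [← h₂.1]
      change β'.1 / (γ.1 * ((α'.1 / α.1) * 1)) = β.1 / γ.1
      rw [e1']
      exact aux (G := Additive A) _ _ _ _
    · have := mul_mem h₂.2 hn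
      have aux : ∀ {G : Type _} [AddCommGroup G] (a b a' c m n y : G),
          b - a + a' + (m + n) - (c + ((a' - a) + m)) - y = b - c - y + n := by intros; abel
      convert this using 1
      change β'.2 / (γ.2 * ((α'.2 / α.2) * m)) / y.2 = β.2 / γ.2 / y.2 * n
      rw [e2]
      exact aux (G := Additive P) _ _ _ _ _ _ _

/-- The coherent configuration of the Schur ring with basic sets `{a} × N a g`. -/
def cosetConfiguration {A P : Type u} [CommGroup A] [CommGroup P] [Finite A] [Finite P]
    (N : A → Subgroup P) (hN : IsCompatibleFamily N) : CoherentConfiguration (A × P) where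
  rels := Set.range (cosetRel N)
  isPartition := by
    refine ⟨?_, ?_⟩
    · rintro ⟨x, hx⟩
      have : ((1 : A × P), x) ∈ cosetRel N x := by
        rw [mem_cosetRel, div_one]; exact .refl _
      rw [hx] at this
      exact this
    · rintro ⟨α, β⟩
      refine ⟨cosetRel N (β / α), ⟨⟨_, rfl⟩, SameCoset.refl _⟩, ?_⟩
      rintro _ ⟨⟨x, rfl⟩, hx⟩
      exact cosetRel_eq_iff.2 hx
  diagonal_eq := by
    refine ⟨{cosetRel N 1}, by simp, ?_⟩
    ext ⟨α, β⟩
    simp only [Set.sUnion_singleton, mem_cosetRel, SameCoset.one_iff hN.one, div_eq_one,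
      Set.mem_diagonal_iff, eq_comm]
  swap_mem := by
    rintro _ ⟨x, rfl⟩
    refine ⟨x⁻¹, ?_⟩
    ext ⟨α, β⟩
    constructor
    · intro h
      have := h.inv hN
      rwa [inv_inv, inv_div] at this
    · intro h
      have := SameCoset.inv hN h
      rwa [inv_div] at this
  ncard_eq := by
    rintro _ ⟨x, rfl⟩ _ ⟨y, rfl⟩ _ ⟨z, rfl⟩ ⟨α, β⟩ h ⟨α', β'⟩ hz
    exact le_antisymm (ncard_cosetRel_le hN h hz) (ncard_cosetRel_le hN hz h)

/-- A coloring of `Ω × Ω` by the cosets of the family `N` with the same triangles as the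
coset configuration of `N`. -/
structure IsCosetColoring (N : A → Subgroup P) {Ω : Type*} (F : A × P → Ω → Ω → Prop) : Prop where
  exists_color : ∀ α β, ∃ x, F x α β
  color_iff : ∀ {x y α β}, F x α β → (F y α β ↔ SameCoset N x y)
  color_mul : ∀ {x y z α β γ}, F x α β → F y β γ → F z α γ →
    ∃ u, SameCoset N x u ∧ SameCoset N y (z / u)
  exists_mid : ∀ {x y α γ}, F (x * y) α γ → ∃ β, F x α β ∧ F y β γ
  one_iff : ∀ {α β}, F 1 α β ↔ α = β

/-! ### Color maps: existence and uniqueness -/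

namespace IsCosetColoring

variable {N : A → Subgroup P} {Ω : Type*} {F : A × P → Ω → Ω → Prop}

/-- Colors over `1 : A` are singletons because `N 1 = ⊥`, so composing with one of them leaves no
ambiguity. -/
theorem thin_mul (hF : IsCosetColoring N F) (hN : N 1 = ⊥) {g : P} {y : A × P} {α β γ : Ω}
    (h : F (1, g) α β) (h' : F y β γ) : F ((1, g) * y) α γ := by
  obtain ⟨z, hz⟩ := hF.exists_color α γ
  obtain ⟨u, hu, hu'⟩ := hF.color_mul h h' hz
  obtain rfl := hu.eq_of_fst_eq_one hN rfl
  refine (hF.color_iff hz).2 ?_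
  have := (hu'.mul_left g).symm
  rwa [mul_div_cancel] at this

theorem mul_thin (hF : IsCosetColoring N F) (hN : N 1 = ⊥) {g : P} {y : A × P} {α β γ : Ω}
    (h : F y α β) (h' : F (1, g) β γ) : F ((1, g) * y) α γ := by
  obtain ⟨z, hz⟩ := hF.exists_color α γ
  obtain ⟨u, hu, hu'⟩ := hF.color_mul h h' hz
  have e : (1, g) * u = z := by rw [← hu'.eq_of_fst_eq_one hN rfl, div_mul_cancel]
  refine (hF.color_iff hz).2 ?_
  have := (hu.mul_left g).symm
  rwa [e] at this

theorem exists_of_point (hF : IsCosetColoring N F) (x : A × P) (α : Ω) : ∃ β, F x α β := by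
  have : F (x * x⁻¹) α α := by rw [mul_inv_cancel]; exact hF.one_iff.2 rfl
  obtain ⟨β, h, -⟩ := hF.exists_mid this
  exact ⟨β, h⟩

theorem symm (hF : IsCosetColoring N F) (hN : IsCompatibleFamily N) {x : A × P} {α β : Ω}
    (h : F x α β) : F x⁻¹ β α := by
  obtain ⟨y, hy⟩ := hF.exists_color β α
  obtain ⟨u, hu, hu'⟩ := hF.color_mul h hy (hF.one_iff.2 rfl)
  rw [one_div] at hu'
  exact (hF.color_iff hy).2 (hu'.trans (hu.inv hN).symm)

/-- Two points that have the same color from a common point differ by a thin color. -/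
theorem exists_thin (hF : IsCosetColoring N F) (hN : IsCompatibleFamily N) {x : A × P}
    {α β γ : Ω} (h : F x α β) (h' : F x α γ) : ∃ g : P, F (1, g) β γ := by
  obtain ⟨⟨a, g⟩, hz⟩ := hF.exists_color β γ
  obtain ⟨u, hu, hu'⟩ := hF.color_mul (hF.symm hN h) h' hz
  have h1 := hu.1
  have h2 := hu'.1
  simp only [Prod.fst_div, Prod.fst_inv] at h1 h2
  rw [h1, div_inv_eq_mul, mul_eq_right] at h2
  exact ⟨g, h2 ▸ hz⟩

theorem thin_unique (hF : IsCosetColoring N F) (hN : IsCompatibleFamily N) {g : P}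
    {α β γ : Ω} (h : F (1, g) α β) (h' : F (1, g) α γ) : β = γ := by
  have h1 := hF.symm hN h
  rw [Prod.inv_mk, inv_one] at h1
  have := hF.thin_mul hN.one h1 h'
  rw [Prod.mk_mul_mk, inv_mul_cancel, mul_one] at this
  exact hF.one_iff.1 this

/-- A map from `A × P` that respects the colors. -/
def IsColorMap (F : A × P → Ω → Ω → Prop) (f : A × P → Ω) : Prop := ∀ x y, F (y / x) (f x) (f y)

theorem IsColorMap.color_iff {f : A × P → Ω} (hf : IsColorMap F f) (hF : IsCosetColoring N F)
    {x α β : A × P} : F x (f α) (f β) ↔ (α, β) ∈ cosetRel N x :=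
  (hF.color_iff (hf α β)).trans ⟨.symm, .symm⟩

theorem IsColorMap.apply_one {f : A × P → Ω} (hf : IsColorMap F f) (x : A × P) :
    F x (f 1) (f x) := by
  simpa using hf 1 x

/-- For surjectivity, a point with color `x` from `f 1` differs from `f x` by a thin color `(1, g)`,
hence equals `f ((1, g) * x)`. -/
theorem IsColorMap.bijective {f : A × P → Ω} (hf : IsColorMap F f) (hF : IsCosetColoring N F)
    (hN : IsCompatibleFamily N) : Function.Bijective f := by
  constructor
  · intro x y hxy
    have := hf x y
    rw [hxy] at this
    have := (hF.color_iff (hF.one_iff.2 rfl)).1 this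
    rw [SameCoset.one_iff hN.one, div_eq_one] at this
    exact this.symm
  · intro β
    obtain ⟨x, hx⟩ := hF.exists_color (f 1) β
    obtain ⟨g, hg⟩ := hF.exists_thin hN (hf.apply_one x) hx
    refine ⟨(1, g) * x, hF.thin_unique hN ?_ hg⟩
    have := hf x ((1, g) * x)
    rwa [mul_div_cancel_right] at this

/-- The thin colors `w a` from `f (a, 1)` to `f' (a, 1)` form a function whose coboundary is trivial
modulo `N`; rigidity forces `w = 1`, and thin translation extends the equality to all of `A × P`. -/
theorem IsColorMap.ext {f f' : A × P → Ω} (hf : IsColorMap F f) (hf' : IsColorMap F f')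
    (hF : IsCosetColoring N F) (hN : IsCompatibleFamily N) (hR : IsRigidFamily N)
    (h : f 1 = f' 1) : f = f' := by
  have key : ∀ a : A, ∃ g : P, F (1, g) (f (a, 1)) (f' (a, 1)) := fun a =>
    hF.exists_thin hN (hf.apply_one (a, 1)) (h ▸ hf'.apply_one (a, 1))
  choose w hw using key
  have hw1 : w 1 = 1 := by
    have h1 : F (1, w 1) (f 1) (f' 1) := hw 1
    rw [h] at h1
    have := (hF.color_iff (hF.one_iff.2 rfl)).1 h1
    rw [SameCoset.one_iff hN.one] at this
    exact congrArg Prod.snd this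
  have hw0 := hR.eq_one w hw1 fun a b => by
    have h1 := hF.symm hN (hw a)
    rw [Prod.inv_mk, inv_one] at h1
    have h2 := hF.mul_thin hN.one (hF.thin_mul hN.one h1 (hf (a, 1) (b, 1))) (hw b)
    have h3 := ((hF.color_iff (hf' (a, 1) (b, 1))).1 h2).2
    simpa [div_eq_mul_inv] using h3
  funext ⟨a, g⟩
  have ha : f (a, 1) = f' (a, 1) := by
    have := hw a
    rw [hw0 a] at this
    exact hF.one_iff.1 this
  refine hF.thin_unique hN (g := g) (α := f (a, 1)) ?_ ?_
  · simpa using hf (a, 1) (a, g)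
  · simpa [ha] using hf' (a, 1) (a, g)

theorem exists_isColorMap (hF : IsCosetColoring N F) (hN : IsCompatibleFamily N)
    (hR : IsRigidFamily N) (ω : Ω) : ∃ f, IsColorMap F f ∧ f 1 = ω := by
  choose p hp using fun a : A => hF.exists_of_point (a, 1) ω
  have hp1 : p 1 = ω := (hF.one_iff.1 (hp 1)).symm
  have key : ∀ a b, ∃ c : P, F (b / a, c) (p a) (p b) := fun a b => by
    obtain ⟨⟨d, c⟩, h⟩ := hF.exists_color (p a) (p b)
    obtain ⟨u, hu, hu'⟩ := hF.color_mul (hp a) h (hp b)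
    have h1 := hu.1
    have h2 := hu'.1
    simp only [Prod.fst_div] at h1 h2
    rw [h1] at h2
    exact ⟨c, h2 ▸ h⟩
  -- Where rigidity requires `c = 1` on the nose, not only modulo `N`, the representative is fixed
  -- by hand.
  have key' : ∀ a b, ∃ c : P, F (b / a, c) (p a) (p b) ∧ (a = b ∨ a = 1 → c = 1) := fun a b => by
    by_cases h : a = b ∨ a = 1
    · refine ⟨1, ?_, fun _ => rfl⟩
      rcases h with rfl | rfl
      · rw [div_self']; exact hF.one_iff.2 rfl
      · rw [div_one, hp1]; exact hp b
    · exact (key a b).imp fun c hc => ⟨hc, fun h' => absurd h' h⟩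
  choose c hc hc1 using key'
  obtain ⟨w, hw1, hw⟩ := hR.exists_solution c (fun a => hc1 a a (.inl rfl))
    (fun a => hc1 1 a (.inr rfl)) fun a b => by
      have h := ((hF.color_iff (hF.symm hN (hc b a))).1 (hc a b)).2
      simpa [hN.inv] using h
  -- The corrected base point for `a` is `p a` moved by `w a`; the factor `x.2` then moves it along
  -- its thin orbit.
  choose τ hτ using fun x : A × P => hF.exists_of_point (1, w x.1 * x.2) (p x.1)
  refine ⟨τ, ?_, ?_⟩
  · rintro ⟨a, g⟩ ⟨b, h⟩
    have h1 := hF.symm hN (hτ (a, g))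
    rw [Prod.inv_mk, inv_one] at h1
    have h2 := hF.mul_thin hN.one (hF.thin_mul hN.one h1 (hc a b)) (hτ (b, h))
    refine (hF.color_iff h2).2 (SameCoset.symm ⟨by simp, ?_⟩)
    have aux : ∀ {G : Type _} [AddCommGroup G] (c w v g h : G),
        v + h + (-(w + g) + c) - (h - g) = c + (v - w) := by intros; abel
    have e : w b * h * ((w a * g)⁻¹ * c a b) / (h / g) = c a b * (w b / w a) :=
      aux (G := Additive P) _ _ _ _ _
    exact e ▸ hw a b
  · have := hτ 1
    simp only [Prod.fst_one, Prod.snd_one, hw1, mul_one, hp1] at this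
    exact (hF.one_iff.1 this).symm

end IsCosetColoring

end Coloring

/-! ### Consequences of rigidity for algebraic isomorphisms -/

namespace CoherentConfiguration

section AlgIso

variable {A P : Type u} [CommGroup A] [CommGroup P] [Finite A] [Finite P] {N : A → Subgroup P}
  {hN : IsCompatibleFamily N} {Ω : Type v} [Finite Ω] {Y : CoherentConfiguration Ω}

/-- The coloring of pairs of points of `Y` given by an algebraic isomorphism from a coset
configuration to `Y`. -/
def AlgIso.color (φ : AlgIso (cosetConfiguration N hN) Y) (x : A × P) (α β : Ω) : Prop :=
  (α, β) ∈ (φ.toEquiv ⟨cosetRel N x, x, rfl⟩ : Set (Ω × Ω))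

/-- Only the positivity of intersection numbers matters: triangles in `Y` are compared with
triangles `1, u, z` in `A × P`. -/
theorem AlgIso.isCosetColoring (φ : AlgIso (cosetConfiguration N hN) Y) :
    IsCosetColoring N φ.color := by
  have exists_color : ∀ α β, ∃ x, φ.color x α β := by
    intro α β
    obtain ⟨s, ⟨hs, hmem⟩, -⟩ := Y.isPartition.2 (α, β)
    obtain ⟨⟨_, x, rfl⟩, hx⟩ := φ.toEquiv.surjective ⟨s, hs⟩
    exact ⟨x, by rw [AlgIso.color, hx]; exact hmem⟩
  have color_iff : ∀ {x y α β}, φ.color x α β → (φ.color y α β ↔ SameCoset N x y) := by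
    intro x y α β h
    rw [← cosetRel_eq_iff]
    constructor
    · intro h'
      have := φ.toEquiv.injective (Subtype.ext
        (Y.eq_of_mem_of_mem (φ.toEquiv _).2 (φ.toEquiv _).2 h h'))
      exact congrArg Subtype.val this
    · intro h'
      simpa only [AlgIso.color, h'] using h
  have self_mem : ∀ z : A × P, ((1 : A × P), z) ∈ cosetRel N z := fun z => by
    rw [mem_cosetRel, div_one]
    exact .refl _
  have exists_mid : ∀ {x y α γ}, φ.color (x * y) α γ → ∃ β, φ.color x α β ∧ φ.color y β γ := by
    intro x y α γ h
    refine (φ.exists_triangle_iff ⟨cosetRel N x, x, rfl⟩ ⟨cosetRel N y, y, rfl⟩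
      ⟨cosetRel N (x * y), x * y, rfl⟩ (self_mem _) h).2 ⟨x, self_mem _, ?_⟩
    change SameCoset N y (x * y / x)
    rw [mul_div_cancel_left]
    exact .refl _
  have one_self : ∀ α, φ.color 1 α α := by
    intro α
    obtain ⟨y, hy⟩ := exists_color α α
    -- Write the color `y` of `(α, α)` as `1 * y`. The midpoint `β` satisfies `F y β α`, and `y`
    -- meets the diagonal, so `β = α`.
    obtain ⟨β, h1, h2⟩ := exists_mid (x := 1) (by rwa [one_mul])
    obtain rfl := Y.eq_of_mem_of_diag_mem (φ.toEquiv _).2 hy h2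
    exact h1
  refine ⟨exists_color, color_iff, ?_, exists_mid, ?_⟩
  · intro x y z α β γ hx hy hz
    obtain ⟨u, h1, h2⟩ := (φ.exists_triangle_iff ⟨cosetRel N x, x, rfl⟩ ⟨cosetRel N y, y, rfl⟩
      ⟨cosetRel N z, z, rfl⟩ (self_mem _) hz).1 ⟨β, hx, hy⟩
    exact ⟨u, by simpa [mem_cosetRel] using h1, h2⟩
  · intro α β
    refine ⟨fun h => Y.eq_of_mem_of_diag_mem (φ.toEquiv _).2 (one_self α) h, ?_⟩
    rintro rfl
    exact one_self _

theorem AlgIso.exists_isColorMap (φ : AlgIso (cosetConfiguration N hN) Y) (hR : IsRigidFamily N)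
    (ω : Ω) : ∃ f : A × P ≃ Ω, IsCosetColoring.IsColorMap φ.color f ∧ f 1 = ω := by
  obtain ⟨f, hf, h1⟩ := φ.isCosetColoring.exists_isColorMap hN hR ω
  exact ⟨Equiv.ofBijective f (hf.bijective φ.isCosetColoring hN), hf, h1⟩

theorem AlgIso.isInducedBy_of_isColorMap (φ : AlgIso (cosetConfiguration N hN) Y) {f : A × P ≃ Ω}
    (hf : IsCosetColoring.IsColorMap φ.color f) : φ.IsInducedBy f := by
  rintro ⟨_, x, rfl⟩
  ext ⟨α, β⟩
  obtain ⟨α, rfl⟩ := f.surjective α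
  obtain ⟨β, rfl⟩ := f.surjective β
  refine (hf.color_iff φ.isCosetColoring).trans ⟨fun h => ⟨(α, β), h, rfl⟩, ?_⟩
  rintro ⟨⟨α', β'⟩, h, e⟩
  simp only [Prod.map_apply, Prod.mk.injEq, EmbeddingLike.apply_eq_iff_eq] at e
  exact e.1 ▸ e.2 ▸ h

theorem AlgIso.nonempty (φ : AlgIso (cosetConfiguration N hN) Y) : Nonempty Ω :=
  ⟨(Y.nonempty_of_mem (φ.toEquiv ⟨cosetRel N 1, 1, rfl⟩)).some.1⟩

theorem isSeparable_cosetConfiguration (hR : IsRigidFamily N) :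
    IsSeparable.{u, v} (cosetConfiguration N hN) := by
  intro Ω _ Y φ
  obtain ⟨ω⟩ := φ.nonempty
  obtain ⟨f, hf, -⟩ := φ.exists_isColorMap hR ω
  exact ⟨f, φ.isInducedBy_of_isColorMap hf⟩

theorem AlgIso.isColorMap_comp (φ : AlgIso (cosetConfiguration N hN) Y) {f : A × P → Ω}
    (hf : IsCosetColoring.IsColorMap φ.color f) {e : Equiv.Perm Ω} (he : e ∈ Y.aut) :
    IsCosetColoring.IsColorMap φ.color (e ∘ f) := fun x y =>
  (he _ (φ.toEquiv _).2 _ _).2 (hf x y)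

/-- The automorphism taking `α` to `β` compares the color maps based at these points; any other one,
composed with the first map, is a color map based at `β`. -/
theorem AlgIso.isRegularPermGroup_aut (φ : AlgIso (cosetConfiguration N hN) Y)
    (hR : IsRigidFamily N) : IsRegularPermGroup Y.aut := by
  refine ⟨φ.nonempty, fun α β => ?_⟩
  obtain ⟨f, hf, rfl⟩ := φ.exists_isColorMap hR α
  obtain ⟨f', hf', rfl⟩ := φ.exists_isColorMap hR β
  refine ⟨f.symm.trans f', ⟨?_, by simp⟩, ?_⟩
  · intro s hs α β
    obtain ⟨⟨_, x, rfl⟩, hx⟩ := φ.toEquiv.surjective ⟨s, hs⟩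
    obtain ⟨α, rfl⟩ := f.surjective α
    obtain ⟨β, rfl⟩ := f.surjective β
    have hx' : s = (φ.toEquiv ⟨cosetRel N x, x, rfl⟩ : Set (Ω × Ω)) := congrArg Subtype.val hx.symm
    rw [hx']
    simp only [Equiv.trans_apply, Equiv.symm_apply_apply]
    exact (hf'.color_iff φ.isCosetColoring).trans (hf.color_iff φ.isCosetColoring).symm
  · rintro e ⟨he, h1⟩
    have := (φ.isColorMap_comp hf he).ext hf' φ.isCosetColoring hN hR h1
    ext ω
    obtain ⟨x, rfl⟩ := f.surjective ω
    simpa using congrFun this x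

theorem isCayleyScheme_cosetConfiguration : (cosetConfiguration N hN).IsCayleyScheme := by
  refine ⟨⟨1, ?_⟩, ?_⟩
  · ext ⟨α, β⟩
    simp only [mem_cosetRel, SameCoset.one_iff hN.one, div_eq_one, Set.mem_diagonal_iff, eq_comm]
  · rintro h _ ⟨x, rfl⟩ α β
    simp only [Equiv.coe_mulRight, mem_cosetRel, mul_div_mul_right_eq_div]

theorem not_isSchurian_cosetConfiguration (hR : IsRigidFamily N) {a : A} (ha : N a ≠ ⊥) :
    ¬ (cosetConfiguration N hN).IsSchurian := by
  rintro ⟨K, hK⟩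
  obtain ⟨⟨n, hn⟩, hn1⟩ := (N a).ne_bot_iff_exists_ne_one.1 ha
  obtain ⟨y, hy⟩ : cosetRel N (a, 1) ∈ Set.range fun x => MulAction.orbit K x :=
    hK ▸ ⟨(a, 1), rfl⟩
  have h1 : ((1 : A × P), ((a, 1) : A × P)) ∈ cosetRel N (a, 1) := by
    rw [mem_cosetRel, div_one]; exact .refl _
  have h2 : ((1 : A × P), ((a, n) : A × P)) ∈ cosetRel N (a, 1) := by
    rw [mem_cosetRel, div_one]; exact ⟨rfl, by simpa using hn⟩
  rw [← hy] at h1 h2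
  have h3 : ((1 : A × P), a, n) ∈ MulAction.orbit K ((1 : A × P), a, (1 : P)) := by
    rw [MulAction.orbit_eq_iff.2 h1]
    exact h2
  obtain ⟨⟨k, hk⟩, hk'⟩ := h3
  have hk1 : k 1 = 1 := congrArg Prod.fst hk'
  have hk2 : k (a, 1) = (a, n) := congrArg Prod.snd hk'
  -- Elements of `K` preserve their own orbits, so `k` is an automorphism fixing `1`; regularity
  -- makes it trivial, although it moves `(a, 1)` to `(a, n)`.
  have hkaut : k ∈ (cosetConfiguration N hN).aut := by
    intro s hs α β
    rw [hK] at hs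
    obtain ⟨z, rfl⟩ := hs
    change (⟨k, hk⟩ : K) • (α, β) ∈ MulAction.orbit K z ↔ (α, β) ∈ MulAction.orbit K z
    rw [← MulAction.orbit_eq_iff, ← MulAction.orbit_eq_iff, MulAction.orbit_smul]
  have := (((AlgIso.refl (cosetConfiguration N hN)).isRegularPermGroup_aut hR).2 1 1).unique
    ⟨hkaut, hk1⟩ ⟨one_mem _, rfl⟩
  rw [this] at hk2
  exact hn1 (Subtype.ext (congrArg Prod.snd hk2).symm)

/-- An algebraic isomorphism from a rigid coset configuration to a Cayley scheme is induced by a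
group isomorphism. -/
theorem AlgIso.exists_mulEquiv {H : Type v} [Group H] [Finite H] {Y : CoherentConfiguration H}
    (φ : AlgIso (cosetConfiguration N hN) Y) (hR : IsRigidFamily N) (hY : Y.IsCayleyScheme) :
    ∃ f : A × P ≃* H, φ.IsInducedBy f.toEquiv := by
  obtain ⟨f, hf, h1⟩ := φ.exists_isColorMap hR 1
  refine ⟨{ f with map_mul' := fun x y => ?_ }, φ.isInducedBy_of_isColorMap hf⟩
  have hcomp : IsCosetColoring.IsColorMap φ.color fun x => f (x * y) := fun u v => by
    simpa only [mul_div_mul_right_eq_div] using hf (u * y) (v * y)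
  have := hcomp.ext (φ.isColorMap_comp hf (hY.2 (f y))) φ.isCosetColoring hN hR (by simp [h1])
  exact congrFun this x

end AlgIso

end CoherentConfiguration

/-! ### Three subgroups of order `p` in a group of order `p ^ 2` -/

section Triple

variable {P : Type*} [CommGroup P]

/-- The quotient `z / (x * y)` lies in both `Q₀` and `Q₁`, so `z = x * y`. Then `(y / x) * z = y *
y` lies in `Q₂` as well as `Q₁`, and the absence of involutions gives `y = 1`. -/
theorem eq_one_of_div_mem {Q₀ Q₁ Q₂ : Subgroup P} (h01 : Disjoint Q₀ Q₁) (h02 : Disjoint Q₀ Q₂)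
    (h12 : Disjoint Q₁ Q₂) (hsq : ∀ x : P, x * x = 1 → x = 1) {x y z : P} (hx : x ∈ Q₀)
    (hy : y ∈ Q₁) (hz : z ∈ Q₂) (hyx : y / x ∈ Q₂) (hzy : z / y ∈ Q₀) (hxz : x / z ∈ Q₁) :
    x = 1 ∧ y = 1 ∧ z = 1 := by
  have e : z / (x * y) = 1 := by
    refine Subgroup.disjoint_def.1 h01 ?_ ?_
    · rw [mul_comm, ← div_div]
      exact div_mem hzy hx
    · rw [← div_div]
      refine div_mem ?_ hy
      rw [← inv_div]
      exact inv_mem hxz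
  have e' : z = x * y := div_eq_one.1 e
  have hyy : y * y ∈ Q₂ := by
    have := mul_mem hyx hz
    rwa [e', ← mul_assoc, div_mul_cancel] at this
  have y1 : y = 1 := hsq y (Subgroup.disjoint_def.1 h12 (mul_mem hy hy) hyy)
  have x1 : x = 1 := by
    rw [y1, one_div] at hyx
    exact Subgroup.disjoint_def.1 h02 hx (inv_mem_iff.1 hyx)
  exact ⟨x1, y1, by rw [e', x1, y1, one_mul]⟩

/-- The conditions say that a homomorphism `Φ` between groups of order `p ^ 3` hits a given element.
Its kernel is trivial by `eq_one_of_div_mem`, so it is onto. -/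
theorem exists_mul_div_mem [Finite P] {p : ℕ} (hP : Nat.card P = p ^ 2) (hp : 0 < p)
    {Q₀ Q₁ Q₂ : Subgroup P} (h0 : Nat.card Q₀ = p) (h1 : Nat.card Q₁ = p) (h2 : Nat.card Q₂ = p)
    (h01 : Disjoint Q₀ Q₁) (h02 : Disjoint Q₀ Q₂) (h12 : Disjoint Q₁ Q₂)
    (hsq : ∀ x : P, x * x = 1 → x = 1) (a b c : P) :
    ∃ x ∈ Q₀, ∃ y ∈ Q₁, ∃ z ∈ Q₂, a * (y / x) ∈ Q₂ ∧ b * (z / y) ∈ Q₀ ∧ c * (x / z) ∈ Q₁ := by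
  let Φ : Q₀ × Q₁ × Q₂ →* (P ⧸ Q₂) × (P ⧸ Q₀) × (P ⧸ Q₁) := MonoidHom.mk'
    (fun w => (((w.2.1 / w.1 : P) : P ⧸ Q₂), ((w.2.2 / w.2.1 : P) : P ⧸ Q₀),
      ((w.1 / w.2.2 : P) : P ⧸ Q₁))) (by
    intro v w
    simp only [Prod.fst_mul, Prod.snd_mul, Subgroup.coe_mul, mul_div_mul_comm,
      QuotientGroup.mk_mul, Prod.mk_mul_mk])
  have hinj : Function.Injective Φ := by
    rw [injective_iff_map_eq_one]
    rintro ⟨⟨x, hx⟩, ⟨y, hy⟩, ⟨z, hz⟩⟩ h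
    have e1 := (QuotientGroup.eq_one_iff _).1 (congrArg Prod.fst h)
    have e2 := (QuotientGroup.eq_one_iff _).1 (congrArg (fun t => t.2.1) h)
    have e3 := (QuotientGroup.eq_one_iff _).1 (congrArg (fun t => t.2.2) h)
    obtain ⟨rfl, rfl, rfl⟩ := eq_one_of_div_mem h01 h02 h12 hsq hx hy hz e1 e2 e3
    rfl
  have hq : ∀ Q : Subgroup P, Nat.card Q = p → Nat.card (P ⧸ Q) = p := fun Q hQ => by
    have := Q.card_eq_card_quotient_mul_card_subgroup
    rw [hP, hQ, pow_two] at this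
    exact (Nat.eq_of_mul_eq_mul_right hp this).symm
  have hcard : Nat.card ((P ⧸ Q₂) × (P ⧸ Q₀) × (P ⧸ Q₁)) ≤ Nat.card (Q₀ × Q₁ × Q₂) := by
    simp only [Nat.card_prod, h0, h1, h2, hq _ h0, hq _ h1, hq _ h2, le_refl]
  obtain ⟨⟨⟨x, hx⟩, ⟨y, hy⟩, ⟨z, hz⟩⟩, h⟩ :=
    (hinj.bijective_of_nat_card_le hcard).2 ((a⁻¹ : P), (b⁻¹ : P), (c⁻¹ : P))
  refine ⟨x, hx, y, hy, z, hz, ?_, ?_, ?_⟩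
  · simpa using QuotientGroup.eq.1 (congrArg Prod.fst h).symm
  · simpa using QuotientGroup.eq.1 (congrArg (fun t => t.2.1) h).symm
  · simpa using QuotientGroup.eq.1 (congrArg (fun t => t.2.2) h).symm

theorem disjoint_of_card_eq_prime {p : ℕ} (hp : p.Prime) {Q Q' : Subgroup P}
    (h : Nat.card Q = p) (h' : Nat.card Q' = p) (hne : Q ≠ Q') : Disjoint Q Q' := by
  have : Finite Q := Nat.finite_of_card_ne_zero (h ▸ hp.ne_zero)
  have : Finite Q' := Nat.finite_of_card_ne_zero (h' ▸ hp.ne_zero)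
  rw [disjoint_iff]
  have hdvd : Nat.card (Q ⊓ Q' : Subgroup P) ∣ p := h ▸ Subgroup.card_dvd_of_le inf_le_left
  rcases (Nat.dvd_prime hp).1 hdvd with h1 | h1
  · exact Subgroup.card_eq_one.1 h1
  · refine absurd ?_ hne
    have e : Q ⊓ Q' = Q := Subgroup.eq_of_le_of_card_ge inf_le_left (by rw [h, h1])
    have e' : Q ⊓ Q' = Q' := Subgroup.eq_of_le_of_card_ge inf_le_right (by rw [h', h1])
    rw [← e, e']

theorem sup_eq_top_of_disjoint [Finite P] {p : ℕ} (hP : Nat.card P = p ^ 2) {Q Q' : Subgroup P}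
    (h : Nat.card Q = p) (h' : Nat.card Q' = p) (hd : Disjoint Q Q') : Q ⊔ Q' = ⊤ := by
  refine Subgroup.eq_top_of_le_card _ ?_
  have hinj : Function.Injective fun w : Q × Q' =>
      (⟨w.1 * w.2, Subgroup.mul_mem_sup w.1.2 w.2.2⟩ : (Q ⊔ Q' : Subgroup P)) := by
    intro v w hvw
    exact Subgroup.mul_injective_of_disjoint hd (congrArg Subtype.val hvw)
  have := Nat.card_le_card_of_injective _ hinj
  rwa [Nat.card_prod, h, h', ← pow_two, ← hP] at this

end Triple

/-! ### The family indexed by the Klein four-group -/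

section KleinFamily

set_option synthInstance.maxSize 1000 in
theorem CyclicSq.two_cases : ∀ x y : CyclicSq 2, x ≠ 1 → y ≠ 1 → x ≠ y →
    ∀ t, t = 1 ∨ t = x ∨ t = y ∨ t = x * y := by decide

theorem CyclicSq.inv_eq_self_of_two : ∀ x : CyclicSq 2, x⁻¹ = x := by decide

theorem CyclicSq.card (n : ℕ) : Nat.card (CyclicSq n) = n ^ 2 := by
  rw [Nat.card_prod, pow_two]
  simp only [Nat.card_congr Multiplicative.toAdd, Nat.card_zmod]

/-- The family of subgroups indexed by `A` whose member at `a i` is `Q i`, and which is trivial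
outside the range of `a`. -/
def familyOfIndex {A P : Type*} [Group P] (a : Fin 3 → A) (Q : Fin 3 → Subgroup P) (t : A) :
    Subgroup P :=
  ⨆ i, ⨆ (_ : a i = t), Q i

theorem familyOfIndex_apply {A P : Type*} [Group P] {a : Fin 3 → A} (ha : Function.Injective a)
    (Q : Fin 3 → Subgroup P) (i : Fin 3) : familyOfIndex a Q (a i) = Q i := by
  simp [familyOfIndex, ha.eq_iff]

theorem familyOfIndex_one {A P : Type*} [Group P] [One A] {a : Fin 3 → A} (ha : ∀ i, a i ≠ 1)
    (Q : Fin 3 → Subgroup P) : familyOfIndex a Q 1 = ⊥ := by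
  simp [familyOfIndex, ha]

variable {a : Fin 3 → CyclicSq 2}

theorem mul_eq_third (ha : Function.Injective a) (ha1 : ∀ i, a i ≠ 1) {i j k : Fin 3}
    (hij : i ≠ j) (hik : i ≠ k) (hjk : j ≠ k) : a i * a j = a k := by
  have := CyclicSq.two_cases (a i) (a j) (ha1 i) (ha1 j) (ha.ne hij) (a k)
  simpa [ha1, ha.eq_iff, hik.symm, hjk.symm, eq_comm] using this

theorem div_eq_third (ha : Function.Injective a) (ha1 : ∀ i, a i ≠ 1) {i j k : Fin 3}
    (hij : i ≠ j) (hik : i ≠ k) (hjk : j ≠ k) : a i / a j = a k := by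
  rw [div_eq_mul_inv, CyclicSq.inv_eq_self_of_two, mul_eq_third ha ha1 hij hik hjk]

theorem eq_one_or_exists_index (ha : Function.Injective a) (ha1 : ∀ i, a i ≠ 1) (t : CyclicSq 2) :
    t = 1 ∨ ∃ i, t = a i := by
  rcases CyclicSq.two_cases (a 0) (a 1) (ha1 0) (ha1 1) (ha.ne (by decide)) t with h | h | h | h
  · exact .inl h
  · exact .inr ⟨0, h⟩
  · exact .inr ⟨1, h⟩
  · exact .inr ⟨2, h.trans (mul_eq_third ha ha1 (by decide) (by decide) (by decide))⟩

variable {p : ℕ} [hp : Fact p.Prime] {Q : Fin 3 → Subgroup (CyclicSq p)}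

theorem isCompatibleFamily_familyOfIndex (ha : Function.Injective a) (ha1 : ∀ i, a i ≠ 1)
    (hQ : Function.Injective Q) (hQp : ∀ i, Nat.card (Q i) = p) :
    IsCompatibleFamily (familyOfIndex a Q) where
  one := familyOfIndex_one ha1 Q
  inv s := by rw [CyclicSq.inv_eq_self_of_two]
  mul s t := by
    rcases eq_one_or_exists_index ha ha1 s with rfl | ⟨i, rfl⟩
    · rw [one_mul]
      exact le_sup_right
    rcases eq_one_or_exists_index ha ha1 t with rfl | ⟨j, rfl⟩
    · rw [mul_one]
      exact le_sup_left
    by_cases hij : i = j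
    · have : a i * a j = 1 := by rw [hij, mul_eq_one_iff_eq_inv, CyclicSq.inv_eq_self_of_two]
      rw [this, familyOfIndex_one ha1]
      exact bot_le
    · rw [familyOfIndex_apply ha, familyOfIndex_apply ha,
        sup_eq_top_of_disjoint (CyclicSq.card p) (hQp i) (hQp j)
          (disjoint_of_card_eq_prime hp.out (hQp i) (hQp j) (hQ.ne hij))]
      exact le_top

theorem CyclicSq.eq_one_of_mul_self_eq_one (hp2 : p ≠ 2) (x : CyclicSq p) (h : x * x = 1) :
    x = 1 := by
  rw [← orderOf_eq_one_iff, ← Nat.dvd_one]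
  have hc : Nat.Coprime 2 (p ^ 2) :=
    Nat.Coprime.pow_right 2 ((Nat.coprime_primes Nat.prime_two hp.out).2 hp2.symm)
  rw [← hc.gcd_eq_one]
  refine Nat.dvd_gcd (orderOf_dvd_of_pow_eq_one (by rw [pow_two, h])) ?_
  rw [← CyclicSq.card p]
  exact orderOf_dvd_natCard x

/-- Pairs involving `1` amount to `w (a i) ∈ Q i`. Up to antisymmetry three pairs remain, taken
cyclically, and the subgroup attached to each is the third one, since `a i / a j = a k`. -/
theorem isRigidFamily_familyOfIndex (hp2 : p ≠ 2) (ha : Function.Injective a)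
    (ha1 : ∀ i, a i ≠ 1) (hQ : Function.Injective Q) (hQp : ∀ i, Nat.card (Q i) = p) :
    IsRigidFamily (familyOfIndex a Q) := by
  have hd : ∀ i j, i ≠ j → Disjoint (Q i) (Q j) := fun i j hij =>
    disjoint_of_card_eq_prime hp.out (hQp i) (hQp j) (hQ.ne hij)
  have hsq := CyclicSq.eq_one_of_mul_self_eq_one hp2
  have hdiv : ∀ {i j k : Fin 3}, i ≠ j → i ≠ k → j ≠ k → familyOfIndex a Q (a i / a j) = Q k :=
    fun hij hik hjk => by rw [div_eq_third ha ha1 hij hik hjk, familyOfIndex_apply ha]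
  have h10 := hdiv (i := 1) (j := 0) (k := 2) (by decide) (by decide) (by decide)
  have h21 := hdiv (i := 2) (j := 1) (k := 0) (by decide) (by decide) (by decide)
  have h02 := hdiv (i := 0) (j := 2) (k := 1) (by decide) (by decide) (by decide)
  have d01 := hd 0 1 (by decide)
  have d02 := hd 0 2 (by decide)
  have d12 := hd 1 2 (by decide)
  constructor
  · intro w hw1 hw t
    have hmem : ∀ i, w (a i) ∈ Q i := fun i => by
      have := hw 1 (a i)
      rwa [hw1, div_one, div_one, familyOfIndex_apply ha] at this
    obtain ⟨e0, e1, e2⟩ := eq_one_of_div_mem d01 d02 d12 hsq (hmem 0) (hmem 1) (hmem 2)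
      (h10 ▸ hw (a 0) (a 1)) (h21 ▸ hw (a 1) (a 2)) (h02 ▸ hw (a 2) (a 0))
    rcases eq_one_or_exists_index ha ha1 t with rfl | ⟨i, rfl⟩
    · exact hw1
    · fin_cases i
      · exact e0
      · exact e1
      · exact e2
  · intro c hc hc1 hcc
    obtain ⟨x, hx, y, hy, z, hz, h0, h1, h2⟩ := exists_mul_div_mem (CyclicSq.card p) hp.out.pos
      (hQp 0) (hQp 1) (hQp 2) d01 d02 d12 hsq (c (a 0) (a 1)) (c (a 1) (a 2)) (c (a 2) (a 0))
    -- The default value is attained only at the identity of `A`.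
    let w : CyclicSq 2 → CyclicSq p := fun t =>
      if t = a 0 then x else if t = a 1 then y else if t = a 2 then z else 1
    have w1 : w 1 = 1 := by simp [w, (ha1 _).symm]
    have wa : w (a 0) = x ∧ w (a 1) = y ∧ w (a 2) = z := by simp [w, ha.eq_iff]
    obtain ⟨wa0, wa1, wa2⟩ := wa
    refine ⟨w, w1, ?_⟩
    have hsymm : ∀ s t, c s t * (w t / w s) ∈ familyOfIndex a Q (t / s) →
        c t s * (w s / w t) ∈ familyOfIndex a Q (s / t) := fun s t h => by
      -- Dividing the antisymmetry relation by the condition for `(s, t)` cancels `c s t` and leaves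
      -- the condition for `(t, s)`.
      have h' := div_mem (hcc s t) h
      rw [mul_div_mul_left_eq_div, div_eq_mul_inv (c t s), inv_div] at h'
      rwa [← inv_div t, CyclicSq.inv_eq_self_of_two]
    have hself : ∀ t, c t t * (w t / w t) ∈ familyOfIndex a Q (t / t) := fun t => by
      rw [hc, div_self' (w t), mul_one]
      exact one_mem _
    have hone : ∀ t, c 1 t * (w t / w 1) ∈ familyOfIndex a Q (t / 1) := fun t => by
      rw [hc1, one_mul, w1, div_one, div_one]
      rcases eq_one_or_exists_index ha ha1 t with rfl | ⟨i, rfl⟩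
      · rw [w1]
        exact one_mem _
      · rw [familyOfIndex_apply ha]
        fin_cases i
        · exact wa0 ▸ hx
        · exact wa1 ▸ hy
        · exact wa2 ▸ hz
    have g01 : c (a 0) (a 1) * (w (a 1) / w (a 0)) ∈ familyOfIndex a Q (a 1 / a 0) := by
      rwa [h10, wa0, wa1]
    have g12 : c (a 1) (a 2) * (w (a 2) / w (a 1)) ∈ familyOfIndex a Q (a 2 / a 1) := by
      rwa [h21, wa1, wa2]
    have g20 : c (a 2) (a 0) * (w (a 0) / w (a 2)) ∈ familyOfIndex a Q (a 0 / a 2) := by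
      rwa [h02, wa0, wa2]
    intro s t
    rcases eq_one_or_exists_index ha ha1 s with rfl | ⟨i, rfl⟩
    · exact hone t
    rcases eq_one_or_exists_index ha ha1 t with rfl | ⟨j, rfl⟩
    · exact hsymm _ _ (hone _)
    fin_cases i <;> fin_cases j
    exacts [hself _, g01, hsymm _ _ g20, hsymm _ _ g01, hself _, g12, g20, hsymm _ _ g12, hself _]

theorem cosetRel_eq_cayleyRel {A P : Type} [CommGroup A] [CommGroup P] (N : A → Subgroup P)
    (x : A × P) : cosetRel N x = cayleyRel {y | SameCoset N x y} := by
  ext ⟨α, β⟩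
  constructor
  · intro h
    exact ⟨β / α, h, α, by rw [div_mul_cancel]⟩
  · rintro ⟨y, hy, g, e⟩
    simp only [Prod.mk.injEq] at e
    obtain ⟨rfl, rfl⟩ := e
    rw [mem_cosetRel, mul_div_cancel_right]
    exact hy

theorem range_cosetRel_familyOfIndex (ha : Function.Injective a) (ha1 : ∀ i, a i ≠ 1) :
    Set.range (cosetRel (familyOfIndex a Q)) = cayleyRel '' basicSets p a Q := by
  have h1 : ∀ g : CyclicSq p, {y | SameCoset (familyOfIndex a Q) (1, g) y} = {(1, g)} := by
    intro g
    ext y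
    refine ⟨fun h => h.eq_of_fst_eq_one (familyOfIndex_one ha1 Q) rfl, ?_⟩
    rintro rfl
    exact SameCoset.refl _
  have h2 : ∀ (g : CyclicSq p) (i : Fin 3), {y | SameCoset (familyOfIndex a Q) (a i, g) y} =
      (fun h : CyclicSq p => (a i, h * g)) '' (Q i : Set (CyclicSq p)) := by
    intro g i
    ext ⟨b, y⟩
    constructor
    · rintro ⟨rfl, h⟩
      rw [familyOfIndex_apply ha] at h
      exact ⟨_, h, by simp⟩
    · rintro ⟨h, hh, e⟩
      simp only [Prod.mk.injEq] at e
      obtain ⟨rfl, rfl⟩ := e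
      refine ⟨rfl, ?_⟩
      rw [familyOfIndex_apply ha, mul_div_cancel_right]
      exact hh
  ext s
  constructor
  · rintro ⟨⟨t, g⟩, rfl⟩
    refine ⟨_, ?_, (cosetRel_eq_cayleyRel _ _).symm⟩
    rcases eq_one_or_exists_index ha ha1 t with rfl | ⟨i, rfl⟩
    · exact ⟨g, .inl (h1 g)⟩
    · exact ⟨g, .inr ⟨i, h2 g i⟩⟩
  · rintro ⟨_, ⟨g, rfl | ⟨i, rfl⟩⟩, rfl⟩
    · exact ⟨(1, g), by rw [cosetRel_eq_cayleyRel, h1]⟩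
    · exact ⟨(a i, g), by rw [cosetRel_eq_cayleyRel, h2]⟩

/-- There are three distinct subgroups of order `p` in `C_p × C_p`. -/
theorem exists_three_subgroups (p : ℕ) [hp : Fact p.Prime] :
    ∃ Q : Fin 3 → Subgroup (CyclicSq p), Function.Injective Q ∧ ∀ i, Nat.card (Q i) = p := by
  let C := Multiplicative (ZMod p)
  let f : Fin 3 → (C →* CyclicSq p) :=
    ![MonoidHom.inl C C, MonoidHom.inr C C, (MonoidHom.id C).prod (MonoidHom.id C)]
  let g : C := Multiplicative.ofAdd 1
  have hg : g ≠ 1 := fun h => one_ne_zero (α := ZMod p) (congrArg Multiplicative.toAdd h)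
  -- The subgroups are the two axes and the diagonal; the image of the generator `g` in one of them
  -- lies in neither of the others.
  have hne : ∀ i j, i ≠ j → f i g ∉ (f j).range := by
    intro i j hij
    rintro ⟨x, hx⟩
    fin_cases i <;> fin_cases j <;>
      simp_all only [f, Prod.ext_iff] <;> simp at hx hij <;> grind
  refine ⟨fun i => (f i).range, fun i j hij => ?_, fun i => ?_⟩
  · have hij' : (f i).range = (f j).range := hij
    by_contra h
    exact hne i j h (hij' ▸ ⟨g, rfl⟩)
  · have hinj : Function.Injective (f i) := by
      intro x y hxy
      fin_cases i <;> simpa [f, Prod.ext_iff] using hxy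
    rw [← Nat.card_congr (MonoidHom.ofInjective hinj).toEquiv]
    simp [C]

end KleinFamily

theorem theorem1 (p : ℕ) [Fact p.Prime] (hp : 5 ≤ p) :
    (∃ (Ω : Type) (_ : Finite Ω) (X : CoherentConfiguration Ω),
      X.IsAssociationScheme ∧ Nat.card Ω = 4 * p ^ 2 ∧
        ¬ X.IsSchurian ∧ CoherentConfiguration.IsSeparable.{0, v} X) ∧
    ∀ (a : Fin 3 → CyclicSq 2) (Q : Fin 3 → Subgroup (CyclicSq p)),
      Function.Injective a → (∀ i, a i ≠ 1) →
      Function.Injective Q → (∀ i, Nat.card (Q i) = p) →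
      ∃ X : CoherentConfiguration (CyclicSq 2 × CyclicSq p),
        X.rels = cayleyRel '' basicSets p a Q ∧
        X.IsCayleyScheme ∧
        Nat.card (CyclicSq 2 × CyclicSq p) = 4 * p ^ 2 ∧
        ¬ X.IsSchurian ∧
        CoherentConfiguration.IsSeparable.{0, v} X ∧
        (∀ (Ω : Type v) [Finite Ω] (Y : CoherentConfiguration Ω),
          Nonempty (CoherentConfiguration.AlgIso X Y) → IsRegularPermGroup Y.aut) ∧
        (∀ (H : Type v) [Group H] [Finite H] (Y : CoherentConfiguration H),
          Y.IsCayleyScheme → ∀ φ : CoherentConfiguration.AlgIso X Y,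
            ∃ f : (CyclicSq 2 × CyclicSq p) ≃* H, φ.IsInducedBy f.toEquiv) := by
  have hcard : Nat.card (CyclicSq 2 × CyclicSq p) = 4 * p ^ 2 := by
    rw [Nat.card_prod, CyclicSq.card, CyclicSq.card]
    norm_num
  have hprime : p.Prime := Fact.out
  -- The bare existence claim is the explicit one for a particular choice of `a` and `Q`.
  refine (and_iff_right_of_imp fun h => ?_).2 ?_
  · let a : Fin 3 → CyclicSq 2 := ![(.ofAdd 1, 1), (1, .ofAdd 1), (.ofAdd 1, .ofAdd 1)]
    obtain ⟨Q, hQ, hQp⟩ := exists_three_subgroups p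
    obtain ⟨X, -, hX, -, hs, hsep, -⟩ := h a Q (by decide) (by decide) hQ hQp
    exact ⟨_, _, X, hX.1, hcard, hs, hsep⟩
  · intro a Q ha ha1 hQ hQp
    have hN := isCompatibleFamily_familyOfIndex ha ha1 hQ hQp
    have hR := isRigidFamily_familyOfIndex (by omega) ha ha1 hQ hQp
    have hbot : familyOfIndex a Q (a 0) ≠ ⊥ := by
      rw [familyOfIndex_apply ha]
      intro h
      have := hQp 0
      rw [h, Subgroup.card_bot] at this
      omega
    exact ⟨cosetConfiguration (familyOfIndex a Q) hN, range_cosetRel_familyOfIndex ha ha1,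
      CoherentConfiguration.isCayleyScheme_cosetConfiguration, hcard,
      CoherentConfiguration.not_isSchurian_cosetConfiguration hR hbot,
      CoherentConfiguration.isSeparable_cosetConfiguration hR,
      fun Ω _ Y ⟨φ⟩ => φ.isRegularPermGroup_aut hR,
      fun H _ _ Y hY φ => φ.exists_mulEquiv hR hY⟩
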